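/- Let $\mathcal G=(\mathcal V,\mathcal E,\mathcal W)$ be a finite simple undirected graph with nonzero real edge weights (of either sign), let $W$ be the diagonal matrix of the weights, and fix an arbitrary orientation of the edges. For a graph $\mathcal H$ on $\mathcal V$ let $E(\mathcal H)$ be its oriented incidence matrix (the column of an edge has $1$ at the head, $-1$ at the tail and $0$ elsewhere), and let $L(\mathcal G)=E(\mathcal G)\,W\,E(\mathcal G)^T$ be the weighted Laplacian. Let $\mathcal F\subseteq\mathcal G$ be a spanning forest of $\mathcal G$, that is, an acyclic subgraph on the node set $\mathcal V$ with the same connected components as $\mathcal G$, and let $\mathcal C$ be the graph on $\mathcal V$ whose edges are the edges of $\mathcal G$ that are not in $\mathcal F$. Put $L_e(\mathcal F)=E(\mathcal F)^TE(\mathcal F)$, label the edges of $\mathcal G$ so that those of $\mathcal F$ come first, and put $$R_{(\mathcal F,\mathcal C)}=\begin{bmatrix} I & L_e(\mathcal F)^{-1}E(\mathcal F)^TE(\mathcal C)\end{bmatrix},\qquad L_{ess}(\mathcal F)=L_e(\mathcal F)\,R_{(\mathcal F,\mathcal C)}\,W\,R_{(\mathcal F,\mathcal C)}^T .$$ For a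 square real matrix $A$ that is similar to a real symmetric matrix, let the signature $\sigma(A)=(n_+,n_-,n_0)$ be the numbers of positive, negative and zero eigenvalues of $A$, counted with multiplicity. Then: 1. $L_{ess}(\mathcal F)$ is similar to a real symmetric matrix, $R_{(\mathcal F,\mathcal C)}WR_{(\mathcal F,\mathcal C)}^T$ is symmetric, and $\sigma(L_{ess}(\mathcal F))=\sigma\bigl(R_{(\mathcal F,\mathcal C)}WR_{(\mathcal F,\mathcal C)}^T\bigr)$. 2. If $\mathcal G$ has $c$ connected components and $\sigma(L(\mathcal G))=(n_+,n_-,n_0)$, then $c\le n_0$ and $\sigma\bigl(R_{(\mathcal F,\mathcal C)}WR_{(\mathcal F,\mathcal C)}^T\bigr)=(n_+,n_-,n_0-c)$. 3. The rows of $R_{(\mathcal F,\mathcal C)}$ form a basis of the cut space of $\mathcal G$, that is, of the span in $\mathbb R^{\mathcal E}$ of the signed characteristic vectors of the cuts of $\mathcal G$ (for $S\subseteq\mathcal V$, the vector that is $1$ on the edges entering $S$, $-1$ on the edges leaving $S$, and $0$ elsewhere). -/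

import Mathlib

namespace WeightedLaplacian

open Matrix

noncomputable section

/-- A choice of a tail and a head for every unordered pair of nodes. Restricting it to the edges
orients every graph on `V`, and every orientation of the edges of a graph arises in this way. -/
structure EdgeOrientation (V : Type*) where
  tail : Sym2 V → V
  head : Sym2 V → V
  mk_eq : ∀ e : Sym2 V, s(tail e, head e) = e

variable {V : Type*} [DecidableEq V]

/-- The (oriented) incidence matrix `E(H)`: the column of an edge has `1` at its head, `-1` at its
tail, and `0` elsewhere. -/
def incidence (o : EdgeOrientation V) (H : SimpleGraph V) : Matrix V H.edgeSet ℝ :=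
  Matrix.of fun v e =>
    (if v = o.head (e : Sym2 V) then 1 else 0) - (if v = o.tail (e : Sym2 V) then 1 else 0)

/-- The weighted Laplacian `L(G) = E W Eᵀ`, with `W` the diagonal matrix of the weights. -/
def laplacian (o : EdgeOrientation V) (G : SimpleGraph V) [Fintype G.edgeSet]
    (w : G.edgeSet → ℝ) : Matrix V V ℝ :=
  incidence o G * Matrix.diagonal w * (incidence o G)ᵀ

/-- `F` is a spanning forest of `G`: an acyclic subgraph on all the nodes of `G` that has the same
connected components as `G` (a spanning tree if `G` is connected). -/
structure IsSpanningForest (F G : SimpleGraph V) : Prop where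
  le : F ≤ G
  acyclic : F.IsAcyclic
  reachable : ∀ u v : V, G.Reachable u v → F.Reachable u v

/-- The (unweighted) edge Laplacian `L_e(F) = E(F)ᵀ E(F)`. -/
def edgeLaplacian [Fintype V] (o : EdgeOrientation V) (F : SimpleGraph V) :
    Matrix F.edgeSet F.edgeSet ℝ :=
  (incidence o F)ᵀ * incidence o F

/-- `T_(F,C) = L_e(F)⁻¹ E(F)ᵀ E(C)`, where `C = G \ F` is the cycle subgraph, which has all the
nodes of `G` and those edges of `G` that are not in `F`. -/
def matrixT [Fintype V] (o : EdgeOrientation V) (G F : SimpleGraph V) [Fintype F.edgeSet] :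
    Matrix F.edgeSet (G \ F).edgeSet ℝ :=
  (edgeLaplacian o F)⁻¹ * (incidence o F)ᵀ * incidence o (G \ F)

open Classical in
/-- The labeling of the edges of `G` by the edges of `F` followed by those of `C = G \ F`. -/
def edgeLabeling {F G : SimpleGraph V} (h : F ≤ G) :
    F.edgeSet ⊕ (G \ F).edgeSet ≃ G.edgeSet :=
  ((Equiv.refl _).sumCongr (Equiv.setCongr (SimpleGraph.edgeSet_sdiff G F))).trans
    (Equiv.Set.sumDiffSubset (SimpleGraph.edgeSet_mono h))

/-- `R_(F,C) = [I  T_(F,C)]`, its columns being labeled by the edges of `G`. -/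
def matrixR [Fintype V] (o : EdgeOrientation V) {F G : SimpleGraph V} [Fintype F.edgeSet]
    (h : F ≤ G) : Matrix F.edgeSet G.edgeSet ℝ :=
  Matrix.reindex (Equiv.refl _) (edgeLabeling h) (Matrix.fromCols 1 (matrixT o G F))

/-- `R_(F,C) W R_(F,C)ᵀ`. -/
def matrixRWR [Fintype V] (o : EdgeOrientation V) {F G : SimpleGraph V} [Fintype F.edgeSet]
    [Fintype G.edgeSet] (h : F ≤ G) (w : G.edgeSet → ℝ) : Matrix F.edgeSet F.edgeSet ℝ :=
  matrixR o h * Matrix.diagonal w * (matrixR o h)ᵀ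

/-- The essential edge Laplacian `L_ess(F) = L_e(F) R_(F,C) W R_(F,C)ᵀ`. -/
def essentialEdgeLaplacian [Fintype V] (o : EdgeOrientation V) {F G : SimpleGraph V}
    [Fintype F.edgeSet] [Fintype G.edgeSet] (h : F ≤ G) (w : G.edgeSet → ℝ) :
    Matrix F.edgeSet F.edgeSet ℝ :=
  edgeLaplacian o F * matrixRWR o h w

/-- The numbers of positive, negative and zero real eigenvalues of a square matrix, counted with
algebraic multiplicity. -/
def signature {n : Type*} [Fintype n] [DecidableEq n] (A : Matrix n n ℝ) : ℕ × ℕ × ℕ :=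
  (A.charpoly.roots.countP (fun x => 0 < x),
   A.charpoly.roots.countP (fun x => x < 0),
   A.charpoly.roots.countP (fun x => x = 0))

/-- `A` is similar to a real symmetric matrix (so that all its eigenvalues are real and it is
diagonalizable). -/
def IsSimilarToSymmetric {n : Type*} [Fintype n] [DecidableEq n] (A : Matrix n n ℝ) : Prop :=
  ∃ S B : Matrix n n ℝ, IsUnit S ∧ B.IsSymm ∧ A = S⁻¹ * B * S

/-- The signed characteristic vector of the cut between a set `S` of nodes and its complement:
`1` on the edges that enter `S`, `-1` on those that leave `S`, and `0` elsewhere. -/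
def cutVector (o : EdgeOrientation V) (G : SimpleGraph V) (S : Finset V) : G.edgeSet → ℝ :=
  fun e =>
    if o.head (e : Sym2 V) ∈ S ∧ o.tail (e : Sym2 V) ∉ S then 1
    else if o.tail (e : Sym2 V) ∈ S ∧ o.head (e : Sym2 V) ∉ S then -1
    else 0

/-- The cut space of `G`: the span of the signed characteristic vectors of its cuts. -/
def cutSpace (o : EdgeOrientation V) (G : SimpleGraph V) : Submodule ℝ (G.edgeSet → ℝ) :=
  Submodule.span ℝ (Set.range (cutVector o G))

end

end WeightedLaplacian

/-!
Write `E_F`, `E_G` for the incidence matrices. A row vector `x` satisfies `x E_G = 0` exactly when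
`x` is constant on the connected components of `G`; since these are also the components of `F`, the
matrices `E_F` and `E_G` have the same left kernel. Moreover every edge of a forest is by itself a
cut, so `E_F` has full column rank and `L_e(F) = E_Fᵀ E_F` is positive definite. Hence
`R = L_e(F)⁻¹ E_Fᵀ E_G` satisfies `E_F R = E_G`, which identifies the row space of `R` with that of
`E_G`, the cut space, and gives `L(G) = E_F (R W Rᵀ) E_Fᵀ`.

The nonzero eigenvalues of `E_F · (R W Rᵀ E_Fᵀ)` are those of `(R W Rᵀ E_Fᵀ) · E_F = R W Rᵀ L_e(F)`,
and `|V| - |E(F)|` is the number of components. Finally, writing `L_e(F) = Bᵀ B`, the product of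
`L_e(F)` with a symmetric matrix `A` is similar to `B A Bᵀ`, and Sylvester's law of inertia applies.
-/

namespace WeightedLaplacian

open Matrix Polynomial

theorem range_vecMulLinear_mul_le {R l m n : Type*} [CommSemiring R] [Fintype l] [Fintype m]
    (A : Matrix l m R) (B : Matrix m n R) : (A * B).vecMulLinear.range ≤ B.vecMulLinear.range := by
  rintro _ ⟨x, rfl⟩
  exact ⟨x ᵥ* A, vecMul_vecMul x A B⟩

section Inertia

theorem isSymm_mul_mul_transpose {R m n : Type*} [CommSemiring R] [Fintype n] {A : Matrix n n R}
    (hA : A.IsSymm) (P : Matrix m n R) : (P * A * Pᵀ).IsSymm := by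
  rw [IsSymm, transpose_mul, transpose_mul, transpose_transpose, hA, Matrix.mul_assoc]

variable {n : Type*} [Fintype n] [DecidableEq n]

theorem equivalent_toQuadraticForm'_mul_mul_transpose {R : Type*} [CommRing R] (A : Matrix n n R)
    {P : Matrix n n R} (hP : IsUnit P) :
    (P * A * Pᵀ).toQuadraticForm'.Equivalent A.toQuadraticForm' := by
  have hPT : Invertible Pᵀ := ((isUnit_transpose P).2 hP).invertible
  refine ⟨⟨toLinearEquiv' Pᵀ hPT, fun x => ?_⟩⟩
  calc toLinearMap₂' R A (Pᵀ *ᵥ x) (Pᵀ *ᵥ x)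
      = (Pᵀ *ᵥ x) ⬝ᵥ A *ᵥ Pᵀ *ᵥ x := toLinearMap₂'_apply' A _ _
    _ = x ⬝ᵥ (P * A * Pᵀ) *ᵥ x := by
      rw [← mulVec_mulVec, ← mulVec_mulVec, dotProduct_mulVec x P, mulVec_transpose]
    _ = toLinearMap₂' R (P * A * Pᵀ) x x := (toLinearMap₂'_apply' _ x x).symm

theorem toQuadraticForm'_diagonal {R : Type*} [CommRing R] (d : n → R) :
    (diagonal d).toQuadraticForm' = QuadraticMap.weightedSumSquares R d := by
  ext x
  calc toLinearMap₂' R (diagonal d) x x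
      = x ⬝ᵥ diagonal d *ᵥ x := toLinearMap₂'_apply' _ x x
    _ = QuadraticMap.weightedSumSquares R d x := by
      simp only [dotProduct, mulVec_diagonal, QuadraticMap.weightedSumSquares_apply, smul_eq_mul,
        mul_left_comm]

theorem equivalent_toQuadraticForm'_weightedSumSquares_eigenvalues {A : Matrix n n ℝ}
    (hA : A.IsHermitian) :
    A.toQuadraticForm'.Equivalent (QuadraticMap.weightedSumSquares ℝ hA.eigenvalues) := by
  have hspec : A = hA.eigenvectorUnitary * diagonal hA.eigenvalues *
      (hA.eigenvectorUnitary : Matrix n n ℝ)ᵀ := by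
    conv_lhs => rw [hA.spectral_theorem, Unitary.conjStarAlgAut_apply, star_eq_conjTranspose,
      conjTranspose_eq_transpose_of_trivial]
    rfl
  have hequiv := equivalent_toQuadraticForm'_mul_mul_transpose (diagonal hA.eigenvalues)
    (Unitary.toUnits hA.eigenvectorUnitary).isUnit
  rwa [Unitary.val_toUnits_apply, ← hspec, toQuadraticForm'_diagonal] at hequiv

theorem countP_roots_charpoly {A : Matrix n n ℝ} (hA : A.IsHermitian) (p : ℝ → Prop)
    [DecidablePred p] : A.charpoly.roots.countP p = {i | p (hA.eigenvalues i)}.ncard := by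
  rw [hA.roots_charpoly_eq_eigenvalues, Multiset.countP_map, Set.ncard_eq_toFinset_card',
    Set.toFinset_ofPred]
  rfl

theorem signature_eq_of_isSymm {A : Matrix n n ℝ} (hA : A.IsSymm) :
    signature A = (sigPos A.toQuadraticForm', sigNeg A.toQuadraticForm',
      Module.finrank ℝ A.toQuadraticForm'.radical) := by
  have hA' : A.IsHermitian := isHermitian_iff_isSymm.2 hA
  have hequiv := equivalent_toQuadraticForm'_weightedSumSquares_eigenvalues hA'
  simp only [signature, countP_roots_charpoly hA',
    QuadraticForm.sigPos_of_equiv_weightedSumSquares hequiv,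
    QuadraticForm.sigNeg_of_equiv_weightedSumSquares hequiv,
    QuadraticForm.finrank_radical_of_equiv_weightedSumSquares hequiv]

theorem signature_mul_mul_transpose {A P : Matrix n n ℝ} (hA : A.IsSymm) (hP : IsUnit P) :
    signature (P * A * Pᵀ) = signature A := by
  have hequiv := equivalent_toQuadraticForm'_mul_mul_transpose A hP
  rw [signature_eq_of_isSymm hA, signature_eq_of_isSymm (isSymm_mul_mul_transpose hA P),
    hequiv.sigPos_eq, hequiv.sigNeg_eq, hequiv.rank_radical_eq]

theorem signature_mul_comm (A B : Matrix n n ℝ) : signature (A * B) = signature (B * A) := by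
  simp only [signature, charpoly_mul_comm A B]

theorem signature_mul_comm_of_card_eq {m : Type*} [Fintype m] [DecidableEq m]
    (A : Matrix m n ℝ) (B : Matrix n m ℝ) {c : ℕ} (hc : Fintype.card m = Fintype.card n + c) :
    signature (A * B) = signature (B * A) + (0, 0, c) := by
  have hcharpoly : (A * B).charpoly = X ^ c * (B * A).charpoly := by
    rw [charpoly_mul_comm_of_le A B (by lia), hc, Nat.add_sub_cancel_left]
  have hroots : (A * B).charpoly.roots = c • {0} + (B * A).charpoly.roots := by
    rw [hcharpoly, roots_mul (mul_ne_zero (pow_ne_zero _ X_ne_zero) (charpoly_monic _).ne_zero),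
      roots_X_pow]
  have hzero (p : ℝ → Prop) [DecidablePred p] :
      Multiset.countP p {0} = if p 0 then 1 else 0 := by
    rw [← Multiset.cons_zero, Multiset.countP_cons, Multiset.countP_zero, zero_add]
  simp [signature, hroots, Multiset.countP_nsmul, hzero, add_comm]

open scoped ComplexOrder MatrixOrder Matrix.Norms.L2Operator in
theorem exists_isUnit_eq_conjTranspose_mul_self {𝕜 : Type*} [RCLike 𝕜] {L : Matrix n n 𝕜}
    (hL : L.PosDef) : ∃ B : Matrix n n 𝕜, IsUnit B ∧ L = Bᴴ * B :=
  CStarAlgebra.isStrictlyPositive_iff_eq_star_mul_self.1 hL.isStrictlyPositive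

theorem isSimilarToSymmetric_posDef_mul {L A : Matrix n n ℝ} (hL : L.PosDef) (hA : A.IsSymm) :
    IsSimilarToSymmetric (L * A) := by
  obtain ⟨B, hB, rfl⟩ := exists_isUnit_eq_conjTranspose_mul_self hL
  have hBT : IsUnit Bᵀ := (isUnit_transpose B).2 hB
  have hdet : IsUnit Bᵀ.det := (isUnit_iff_isUnit_det _).1 hBT
  refine ⟨Bᵀ⁻¹, B * A * Bᵀ, isUnit_nonsing_inv_iff.2 hBT, isSymm_mul_mul_transpose hA B, ?_⟩
  rw [conjTranspose_eq_transpose_of_trivial, nonsing_inv_nonsing_inv _ hdet, ← Matrix.mul_assoc,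
    mul_nonsing_inv_cancel_right _ _ hdet, ← Matrix.mul_assoc]

theorem signature_posDef_mul {L A : Matrix n n ℝ} (hL : L.PosDef) (hA : A.IsSymm) :
    signature (L * A) = signature A := by
  obtain ⟨B, hB, rfl⟩ := exists_isUnit_eq_conjTranspose_mul_self hL
  rw [conjTranspose_eq_transpose_of_trivial, Matrix.mul_assoc, signature_mul_comm,
    signature_mul_mul_transpose hA hB]

end Inertia

section Incidence

variable {V : Type*} (o : EdgeOrientation V)

theorem adj_tail_head {G : SimpleGraph V} (e : G.edgeSet) : G.Adj (o.tail e) (o.head e) := by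
  rw [← SimpleGraph.mem_edgeSet, o.mk_eq]
  exact e.2

theorem nonempty_edgeOrientation : Nonempty (EdgeOrientation V) :=
  ⟨fun e => e.out.1, fun e => e.out.2, fun e => e.out_eq⟩

variable [DecidableEq V]

theorem incidence_submatrix_edgeLabeling {F G : SimpleGraph V} (h : F ≤ G) :
    (incidence o G).submatrix id (edgeLabeling h) =
      fromCols (incidence o F) (incidence o (G \ F)) := by
  ext v (e | e) <;> rfl

variable [Fintype V]

theorem vecMul_incidence_apply (G : SimpleGraph V) (x : V → ℝ) (e : G.edgeSet) :
    (x ᵥ* incidence o G) e = x (o.head e) - x (o.tail e) := by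
  simp [vecMul, dotProduct, incidence, mul_sub]

theorem vecMul_incidence_eq_zero_iff_forall_adj {G : SimpleGraph V} {x : V → ℝ} :
    x ᵥ* incidence o G = 0 ↔ ∀ u v, G.Adj u v → x u = x v := by
  simp only [funext_iff, vecMul_incidence_apply, Pi.zero_apply, sub_eq_zero]
  refine ⟨fun h u v huv => ?_, fun h e => (h _ _ (adj_tail_head o e)).symm⟩
  have hedge := h ⟨s(u, v), huv⟩
  rcases Sym2.eq_iff.1 (o.mk_eq s(u, v)) with ⟨htail, hhead⟩ | ⟨htail, hhead⟩ <;>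
    simp_all

theorem vecMul_incidence_eq_zero_iff_lapMatrix_mulVec_eq_zero {G : SimpleGraph V}
    [DecidableRel G.Adj] {x : V → ℝ} :
    x ᵥ* incidence o G = 0 ↔ G.lapMatrix ℝ *ᵥ x = 0 := by
  rw [vecMul_incidence_eq_zero_iff_forall_adj, G.lapMatrix_mulVec_eq_zero_iff_forall_adj]

theorem vecMul_incidence_eq_zero_iff_forall_reachable {G : SimpleGraph V} {x : V → ℝ} :
    x ᵥ* incidence o G = 0 ↔ ∀ u v, G.Reachable u v → x u = x v := by
  classical
  rw [vecMul_incidence_eq_zero_iff_lapMatrix_mulVec_eq_zero,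
    G.lapMatrix_mulVec_eq_zero_iff_forall_reachable]

theorem finrank_ker_vecMulLinear_incidence (G : SimpleGraph V) :
    Module.finrank ℝ (incidence o G).vecMulLinear.ker = Nat.card G.ConnectedComponent := by
  classical
  have hker : (incidence o G).vecMulLinear.ker = (G.lapMatrix ℝ).toLin'.ker := by
    ext x
    exact vecMul_incidence_eq_zero_iff_lapMatrix_mulVec_eq_zero o
  rw [hker, Nat.card_eq_fintype_card,
    SimpleGraph.card_connectedComponent_eq_finrank_ker_toLin'_lapMatrix]

end Incidence

section CutSpace

variable {V : Type*} [Fintype V] [DecidableEq V] (o : EdgeOrientation V)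

theorem cutVector_eq_vecMul_incidence (G : SimpleGraph V) (S : Finset V) :
    cutVector o G S = (fun v => if v ∈ S then 1 else 0) ᵥ* incidence o G := by
  ext e
  rw [vecMul_incidence_apply, cutVector]
  split_ifs <;> simp_all

theorem cutSpace_eq_range_vecMulLinear_incidence (G : SimpleGraph V) :
    cutSpace o G = (incidence o G).vecMulLinear.range := by
  refine le_antisymm (Submodule.span_le.2 ?_) ?_
  · rintro _ ⟨S, rfl⟩
    exact ⟨_, (cutVector_eq_vecMul_incidence o G S).symm⟩
  · rw [range_vecMulLinear, Submodule.span_le]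
    rintro _ ⟨v, rfl⟩
    have hsingle : (fun u => if u ∈ ({v} : Finset V) then (1 : ℝ) else 0) = Pi.single v 1 := by
      ext u
      simp only [Finset.mem_singleton, Pi.single_apply]
    refine Submodule.subset_span ⟨{v}, ?_⟩
    rw [cutVector_eq_vecMul_incidence, hsingle, single_one_vecMul]

open Classical in
/-- The nodes on the head side of the fundamental cut of `F` at `e`, that is, the connected
component of the head of `e` after `e` is removed from `F`. -/
noncomputable def headSide (F : SimpleGraph V) (e : Sym2 V) : Finset V :=
  {v | (F.deleteEdges {e}).Reachable (o.head e) v}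

theorem cutVector_headSide {F : SimpleGraph V} (hF : F.IsAcyclic) (e : F.edgeSet) :
    cutVector o F (headSide o F e) = Pi.single e 1 := by
  have hhead : o.head e ∈ headSide o F e := by simp [headSide]
  have htail : o.tail e ∉ headSide o F e := by
    have hbridge := SimpleGraph.isAcyclic_iff_forall_isBridge.1 hF e.2
    rw [← o.mk_eq e, SimpleGraph.isBridge_iff, o.mk_eq e, SimpleGraph.reachable_comm] at hbridge
    simpa [headSide] using hbridge
  ext f
  rcases eq_or_ne f e with rfl | hne
  · simp [cutVector, hhead, htail]
  · have hadj : (F.deleteEdges {(e : Sym2 V)}).Adj (o.tail f) (o.head f) := by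
      rw [SimpleGraph.deleteEdges_adj, o.mk_eq]
      exact ⟨adj_tail_head o f, fun h => hne (Subtype.ext h)⟩
    have hsame : o.head f ∈ headSide o F e ↔ o.tail f ∈ headSide o F e := by
      simp only [headSide, Finset.mem_filter_univ]
      exact ⟨fun h => h.trans hadj.reachable.symm, fun h => h.trans hadj.reachable⟩
    simp [cutVector, hsame, hne]

theorem cutSpace_eq_top {V : Type*} [Finite V] [DecidableEq V] (o : EdgeOrientation V)
    {F : SimpleGraph V} (hF : F.IsAcyclic) : cutSpace o F = ⊤ := by
  classical
  have := Fintype.ofFinite V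
  rw [eq_top_iff, ← (Pi.basisFun ℝ F.edgeSet).span_eq, Submodule.span_le]
  rintro _ ⟨e, rfl⟩
  rw [Pi.basisFun_apply, ← cutVector_headSide o hF]
  exact Submodule.subset_span ⟨_, rfl⟩

theorem surjective_vecMul_incidence {F : SimpleGraph V} (hF : F.IsAcyclic) :
    Function.Surjective (incidence o F).vecMul :=
  LinearMap.range_eq_top.1 ((cutSpace_eq_range_vecMulLinear_incidence o F).symm.trans
    (cutSpace_eq_top o hF))

theorem card_edgeSet_add_card_connectedComponent {V : Type*} [Fintype V] {F : SimpleGraph V}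
    [Fintype F.edgeSet] (hF : F.IsAcyclic) :
    Fintype.card F.edgeSet + Nat.card F.ConnectedComponent = Fintype.card V := by
  classical
  obtain ⟨o⟩ := nonempty_edgeOrientation (V := V)
  have hrank := LinearMap.finrank_range_add_finrank_ker (incidence o F).vecMulLinear
  rwa [← cutSpace_eq_range_vecMulLinear_incidence, cutSpace_eq_top o hF, finrank_top,
    finrank_ker_vecMulLinear_incidence, Module.finrank_fintype_fun_eq_card,
    Module.finrank_fintype_fun_eq_card] at hrank

end CutSpace

section EssentialEdgeLaplacian

variable {V : Type*} [Fintype V] [DecidableEq V] (o : EdgeOrientation V) {F G : SimpleGraph V}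

theorem IsSpanningForest.card_connectedComponent_eq {V : Type*} {F G : SimpleGraph V}
    (hF : IsSpanningForest F G) :
    Nat.card F.ConnectedComponent = Nat.card G.ConnectedComponent :=
  Nat.card_congr (Quot.congrRight fun u v => ⟨fun h => h.mono hF.le, hF.reachable u v⟩)

theorem IsSpanningForest.mul_incidence_eq_zero_iff {l : Type*} (hF : IsSpanningForest F G)
    (A : Matrix l V ℝ) : A * incidence o F = 0 ↔ A * incidence o G = 0 := by
  have hrow (x : V → ℝ) : x ᵥ* incidence o F = 0 ↔ x ᵥ* incidence o G = 0 := by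
    rw [vecMul_incidence_eq_zero_iff_forall_reachable,
      vecMul_incidence_eq_zero_iff_forall_reachable]
    exact ⟨fun h u v huv => h u v (hF.reachable u v huv), fun h u v huv => h u v (huv.mono hF.le)⟩
  have hmul (H : SimpleGraph V) : A * incidence o H = 0 ↔ ∀ i, A i ᵥ* incidence o H = 0 :=
    funext_iff
  rw [hmul, hmul]
  exact forall_congr' fun i => hrow (A i)

theorem posDef_edgeLaplacian (hF : F.IsAcyclic) : (edgeLaplacian o F).PosDef := by
  classical
  have := Fintype.ofFinite F.edgeSet
  obtain ⟨Q, hQ⟩ := vecMul_surjective_iff_exists_left_inverse.1 (surjective_vecMul_incidence o hF)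
  have hinj : Function.Injective (incidence o F).mulVec := fun x y hxy => by
    simpa [mulVec_mulVec, hQ] using congrArg (Q *ᵥ ·) hxy
  rw [edgeLaplacian, ← conjTranspose_eq_transpose_of_trivial]
  exact PosDef.conjTranspose_mul_self _ hinj

variable [Fintype F.edgeSet]

theorem edgeLaplacian_inv_mul_cancel (hF : F.IsAcyclic) :
    (edgeLaplacian o F)⁻¹ * edgeLaplacian o F = 1 :=
  nonsing_inv_mul _ ((isUnit_iff_isUnit_det _).1 (posDef_edgeLaplacian o hF).isUnit)

theorem matrixR_eq_mul_incidence (hF : F.IsAcyclic) (h : F ≤ G) :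
    matrixR o h = (edgeLaplacian o F)⁻¹ * (incidence o F)ᵀ * incidence o G := by
  have hcols : fromCols 1 (matrixT o G F) =
      ((edgeLaplacian o F)⁻¹ * (incidence o F)ᵀ * incidence o G).submatrix id (edgeLabeling h) := by
    rw [← submatrix_mul_equiv _ _ _ (Equiv.refl V), Equiv.coe_refl, submatrix_id_id,
      incidence_submatrix_edgeLabeling, mul_fromCols, Matrix.mul_assoc _ _ (incidence o F),
      ← edgeLaplacian, edgeLaplacian_inv_mul_cancel o hF, matrixT]
  rw [matrixR, hcols]
  simp

theorem linearIndependent_row_matrixR (h : F ≤ G) : LinearIndependent ℝ (matrixR o h).row := by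
  rw [Fintype.linearIndependent_iff]
  intro g hg f
  have hf := congrFun hg (edgeLabeling h (Sum.inl f))
  simpa [matrixR, row, one_apply] using hf

theorem IsSpanningForest.incidence_mul_matrixR (hF : IsSpanningForest F G) :
    incidence o F * matrixR o hF.le = incidence o G := by
  have hF₀ :
      (1 - incidence o F * (edgeLaplacian o F)⁻¹ * (incidence o F)ᵀ) * incidence o F = 0 := by
    rw [Matrix.sub_mul, Matrix.one_mul, Matrix.mul_assoc, Matrix.mul_assoc, ← edgeLaplacian,
      edgeLaplacian_inv_mul_cancel o hF.acyclic, Matrix.mul_one, sub_self]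
  have hG₀ := (hF.mul_incidence_eq_zero_iff o _).1 hF₀
  rw [Matrix.sub_mul, Matrix.one_mul, sub_eq_zero] at hG₀
  rw [matrixR_eq_mul_incidence o hF.acyclic, ← Matrix.mul_assoc, ← Matrix.mul_assoc, ← hG₀]

theorem IsSpanningForest.span_row_matrixR (hF : IsSpanningForest F G) :
    Submodule.span ℝ (Set.range (matrixR o hF.le).row) = cutSpace o G := by
  rw [← range_vecMulLinear, cutSpace_eq_range_vecMulLinear_incidence]
  apply le_antisymm
  · rw [matrixR_eq_mul_incidence o hF.acyclic]
    exact range_vecMulLinear_mul_le _ _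
  · rw [← hF.incidence_mul_matrixR o]
    exact range_vecMulLinear_mul_le _ _

variable [Fintype G.edgeSet]

theorem isSymm_matrixRWR (h : F ≤ G) (w : G.edgeSet → ℝ) : (matrixRWR o h w).IsSymm :=
  isSymm_mul_mul_transpose (isSymm_diagonal w) _

theorem IsSpanningForest.laplacian_eq (hF : IsSpanningForest F G) (w : G.edgeSet → ℝ) :
    laplacian o G w = incidence o F * (matrixRWR o hF.le w * (incidence o F)ᵀ) := by
  rw [laplacian, ← hF.incidence_mul_matrixR o]
  simp only [matrixRWR, transpose_mul, Matrix.mul_assoc]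

theorem IsSpanningForest.signature_laplacian (hF : IsSpanningForest F G) (w : G.edgeSet → ℝ) :
    signature (laplacian o G w) =
      signature (matrixRWR o hF.le w) + (0, 0, Nat.card G.ConnectedComponent) := by
  have hcard : Fintype.card V = Fintype.card F.edgeSet + Nat.card G.ConnectedComponent := by
    rw [← hF.card_connectedComponent_eq, card_edgeSet_add_card_connectedComponent hF.acyclic]
  rw [hF.laplacian_eq o, signature_mul_comm_of_card_eq _ _ hcard, Matrix.mul_assoc,
    ← edgeLaplacian, signature_mul_comm,
    signature_posDef_mul (posDef_edgeLaplacian o hF.acyclic) (isSymm_matrixRWR o hF.le w)]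

end EssentialEdgeLaplacian

end WeightedLaplacian

open WeightedLaplacian in
theorem mainTheorem4 {V : Type*} [Fintype V] [DecidableEq V]
    (G : SimpleGraph V) [DecidableRel G.Adj] (o : EdgeOrientation V)
    (w : G.edgeSet → ℝ) (hw : ∀ e, w e ≠ 0)
    (F : SimpleGraph V) [DecidableRel F.Adj] (hF : IsSpanningForest F G) :
    -- the signature of the essential edge Laplacian is meaningful ...
    IsSimilarToSymmetric (essentialEdgeLaplacian o hF.le w) ∧
    -- ... and it is the signature of the symmetric matrix `R W Rᵀ`
    (matrixRWR o hF.le w).IsSymm ∧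
    signature (essentialEdgeLaplacian o hF.le w) = signature (matrixRWR o hF.le w) ∧
    -- the signature of `R W Rᵀ` in terms of that of the weighted Laplacian
    (∀ c np nm n0 : ℕ, Nat.card G.ConnectedComponent = c →
      signature (laplacian o G w) = (np, nm, n0) →
      c ≤ n0 ∧ signature (matrixRWR o hF.le w) = (np, nm, n0 - c)) ∧
    -- the rows of `R` form a basis of the cut space
    LinearIndependent ℝ (matrixR o hF.le).row ∧
    Submodule.span ℝ (Set.range (matrixR o hF.le).row) = cutSpace o G := by
  have hL := posDef_edgeLaplacian o hF.acyclic
  have hM := isSymm_matrixRWR o hF.le w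
  refine ⟨isSimilarToSymmetric_posDef_mul hL hM, hM, signature_posDef_mul hL hM, ?_,
    linearIndependent_row_matrixR o hF.le, hF.span_row_matrixR o⟩
  rintro _ np nm n0 rfl hsig
  rw [hF.signature_laplacian o w] at hsig
  simp only [Prod.ext_iff, Prod.fst_add, Prod.snd_add] at hsig ⊢
  lia
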